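/- Let $\mathcal{M}(2;\mathbb{C})\simeq\mathbb{C}^4$ be the space of complex $2\times 2$ matrices and let $\Phi_{\mathrm{Id}}\colon\mathcal{M}(2;\mathbb{C})\to\mathcal{M}(2;\mathbb{C})$, $M\mapsto M^2$. Let $\mathrm{Aut}(\mathcal{M}(2;\mathbb{C});\Phi_{\mathrm{Id}})$ be the group, under composition, of the holomorphic automorphisms $g$ of $\mathcal{M}(2;\mathbb{C})$ (holomorphic bijections with holomorphic inverse) such that $g\circ\Phi_{\mathrm{Id}}=\Phi_{\mathrm{Id}}\circ g$. For $P\in\mathrm{GL}(2;\mathbb{C})$ let $\sigma_P\colon M\mapsto PMP^{-1}$, and let $\mathcal{T}\colon M\mapsto {}^{t}M$ be the transposition. Then $\mathrm{Aut}(\mathcal{M}(2;\mathbb{C});\Phi_{\mathrm{Id}})$ is generated by $\mathcal{T}$ and the $\sigma_P$, $P\in\mathrm{GL}(2;\mathbb{C})$. More precisely, there is a group isomorphism $$\mathrm{PGL}(2;\mathbb{C})\rtimes\mathbb{Z}/2\mathbb{Z}\;\simeq\;\mathrm{Aut}(\mathcal{M}(2;\mathbb{C});\Phi_{\mathrm{Id}}),$$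 where the nontrivial element of $\mathbb{Z}/2\mathbb{Z}$ acts on $\mathrm{PGL}(2;\mathbb{C})$ by $[P]\mapsto[({}^{t}P)^{-1}]$; it sends $[P]\in\mathrm{PGL}(2;\mathbb{C})$ to $\sigma_P$ and the nontrivial element of $\mathbb{Z}/2\mathbb{Z}$ to $\mathcal{T}$. -/

import Mathlib

open scoped MatrixGroups

-- A norm on the space of complex matrices, needed to speak of holomorphic maps. It induces the
-- usual topology of `ℂ⁴`; all norms being equivalent, holomorphy does not depend on the choice.
attribute [local instance] Matrix.linftyOpNormedRing Matrix.linftyOpNormedAlgebra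

/-- `Aut(E; f)`: the group (under composition) of the holomorphic automorphisms of the complex
normed space `E`, that is the bijections that are holomorphic together with their inverse, which
commute with the map `f : E → E`. -/
def holAutCentralizer (E : Type*) [NormedAddCommGroup E] [NormedSpace ℂ E] (f : E → E) :
    Subgroup (Equiv.Perm E) where
  carrier := {g | Differentiable ℂ (g : E → E) ∧ Differentiable ℂ (g.symm : E → E) ∧
    (g : E → E) ∘ f = f ∘ (g : E → E)}
  one_mem' := ⟨differentiable_id, differentiable_id, rfl⟩
  mul_mem' := by
    rintro a b ⟨ha, ha', hac⟩ ⟨hb, hb', hbc⟩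
    refine ⟨ha.comp hb, hb'.comp ha', ?_⟩
    funext x
    have h1 := congrFun hac (b x)
    have h2 := congrFun hbc x
    simp only [Function.comp_apply, Equiv.Perm.coe_mul] at h1 h2 ⊢
    rw [h2, h1]
  inv_mem' := by
    rintro a ⟨ha, ha', hac⟩
    refine ⟨ha', ha, ?_⟩
    funext x
    have h1 := congrFun hac (a.symm x)
    simp only [Function.comp_apply, Equiv.apply_symm_apply] at h1
    change a.symm (f x) = f (a.symm x)
    rw [← h1, Equiv.symm_apply_apply]

/-- The squaring map `M ↦ M²` on complex `2 × 2` matrices. -/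
def squareMap (M : Matrix (Fin 2) (Fin 2) ℂ) : Matrix (Fin 2) (Fin 2) ℂ := M ^ 2

/-- The conjugation `σ_P : M ↦ P M P⁻¹`. -/
def conjMap (P : GL (Fin 2) ℂ) : Equiv.Perm (Matrix (Fin 2) (Fin 2) ℂ) where
  toFun M := (P : Matrix (Fin 2) (Fin 2) ℂ) * M * ((P⁻¹ : GL (Fin 2) ℂ) : Matrix (Fin 2) (Fin 2) ℂ)
  invFun M := ((P⁻¹ : GL (Fin 2) ℂ) : Matrix (Fin 2) (Fin 2) ℂ) * M * (P : Matrix (Fin 2) (Fin 2) ℂ)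
  left_inv M := by simp only [mul_assoc, Units.inv_mul, mul_one, Units.inv_mul_cancel_left]
  right_inv M := by simp only [mul_assoc, Units.mul_inv, mul_one, Units.mul_inv_cancel_left]

/-- The transposition `M ↦ ᵗM`. -/
def transposeMap : Equiv.Perm (Matrix (Fin 2) (Fin 2) ℂ) where
  toFun M := M.transpose
  invFun M := M.transpose
  left_inv M := M.transpose_transpose
  right_inv M := M.transpose_transpose

/-- The transpose of an invertible matrix, as an invertible matrix. -/
def transposeGL (P : GL (Fin 2) ℂ) : GL (Fin 2) ℂ where
  val := (P : Matrix (Fin 2) (Fin 2) ℂ).transpose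
  inv := ((P⁻¹ : GL (Fin 2) ℂ) : Matrix (Fin 2) (Fin 2) ℂ).transpose
  val_inv := by rw [← Matrix.transpose_mul, Units.inv_mul, Matrix.transpose_one]
  inv_val := by rw [← Matrix.transpose_mul, Units.mul_inv, Matrix.transpose_one]

/-- The automorphism `P ↦ (ᵗP)⁻¹` of `GL(2; ℂ)`. -/
def contragredientGL : GL (Fin 2) ℂ ≃* GL (Fin 2) ℂ where
  toFun P := (transposeGL P)⁻¹
  invFun P := (transposeGL P)⁻¹
  left_inv P := Units.ext (Matrix.transpose_transpose (P : Matrix (Fin 2) (Fin 2) ℂ))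
  right_inv P := Units.ext (Matrix.transpose_transpose (P : Matrix (Fin 2) (Fin 2) ℂ))
  map_mul' P Q := by
    rw [← mul_inv_rev, inv_inj]
    exact Units.ext (Matrix.transpose_mul _ _)

/-- The automorphism `[P] ↦ [(ᵗP)⁻¹]` of `PGL(2; ℂ)`. -/
def contragredientPGL : MulAut PGL(2, ℂ) :=
  QuotientGroup.congr (Subgroup.center (GL (Fin 2) ℂ)) (Subgroup.center (GL (Fin 2) ℂ))
    contragredientGL
    (Subgroup.characteristic_iff_map_eq.mp Subgroup.centerCharacteristic contragredientGL)

theorem contragredientPGL_mk (P : GL (Fin 2) ℂ) :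
    contragredientPGL (Matrix.ProjGenLinGroup.mk P) =
      Matrix.ProjGenLinGroup.mk (transposeGL P)⁻¹ := rfl

theorem contragredientPGL_sq : contragredientPGL ^ 2 = 1 := by
  ext g
  induction g using Matrix.ProjGenLinGroup.induction_on with
  | mk P =>
    rw [pow_two, MulAut.mul_apply, contragredientPGL_mk, contragredientPGL_mk, MulAut.one_apply]
    exact congrArg _ (contragredientGL.left_inv P)

/-- The action of `ℤ/2ℤ` (written multiplicatively) on `PGL(2; ℂ)` whose nontrivial element acts
by `[P] ↦ [(ᵗP)⁻¹]`. -/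
def contragredientAction : Multiplicative (ZMod 2) →* MulAut PGL(2, ℂ) where
  toFun ε := contragredientPGL ^ (Multiplicative.toAdd ε).val
  map_one' := by rw [toAdd_one, ZMod.val_zero, pow_zero]
  map_mul' a b := by
    rw [toAdd_mul, ZMod.val_add, ← pow_add]
    exact (pow_eq_pow_mod _ contragredientPGL_sq).symm

/-! ### Rigidity of the doubling equation. -/

open Filter Topology

/-! An automorphism `g` commuting with squaring is linear. First, `g 0 = 0`, by a growth argument.
The derivative `D` of `g` at `0` commutes with squaring, as the leading terms of the equation show,
so `h = D⁻¹ ∘ g` does too and is tangent to the identity at `0`. Such an `h` is the identity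
(`eq_id_of_map_sq`): a curve with `γ (2s) = γ(s)²` and `γ 0 = 1` is determined for `s > 0` by its
velocity at `0`, which forces `h (c • exp X) = c • h (exp X)`. Differentiating at `c = 0` gives `h
(exp X) = exp X`, and exponentials fill a neighbourhood of `1`.

A linear bijection commuting with squaring preserves `M N + N M`. The images of the matrix units
then satisfy the relations of matrix units or of their transposes, so `g` is `σ_P` or `σ_P ∘ 𝒯`. The
semidirect product structure follows because only scalar `P` act trivially and `𝒯` is no
conjugation. -/

/-- Two curves that satisfy `γ (2s) = γ(s)²` and have the same `1`-jet `(1, a)` at `0` agree. -/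
theorem eq_of_doubling {A : Type*} [NormedRing A] [NormedSpace ℝ A] {γ₁ γ₂ : ℝ → A} {a : A}
    (h₁ : ∀ s, γ₁ (2 * s) = γ₁ s ^ 2) (h₂ : ∀ s, γ₂ (2 * s) = γ₂ s ^ 2)
    (d₁ : HasDerivAt γ₁ a 0) (d₂ : HasDerivAt γ₂ a 0) (z₁ : γ₁ 0 = 1) (z₂ : γ₂ 0 = 1)
    {s : ℝ} (hs : 0 < s) : γ₁ s = γ₂ s := by
  have half : ∀ n : ℕ, γ₁ (s / 2 ^ n) = γ₂ (s / 2 ^ n) → γ₁ s = γ₂ s := by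
    intro n
    induction n with
    | zero => simp
    | succ n ih =>
      intro h
      apply ih
      have e : s / 2 ^ n = 2 * (s / 2 ^ (n + 1)) := by rw [pow_succ]; field_simp
      rw [e, h₁, h₂, h]
  have lim : ∀ t : ℝ, Tendsto (fun n : ℕ => t / 2 ^ n) atTop (𝓝 0) := fun t => by
    simpa [div_eq_mul_inv] using
      (tendsto_pow_atTop_nhds_zero_of_lt_one (r := (2 : ℝ)⁻¹) (by norm_num) (by norm_num)).const_mul t
  obtain ⟨C₁, hC₁⟩ := d₁.isBigO_sub.bound
  obtain ⟨C₂, hC₂⟩ := d₂.isBigO_sub.bound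
  obtain ⟨δ, hδ, H⟩ := Metric.eventually_nhds_iff.mp (hC₁.and hC₂)
  set c := C₁ + C₂
  have key : ∀ t, 0 < t → t < δ → γ₁ t = γ₂ t := by
    -- Doubling `t` multiplies the gap by at most `2 (1 + c t) ≤ 2 exp (c t)`. Dividing by `t`
    -- absorbs the `2` and the weight `exp (-(c t))` absorbs the rest, so `b (2 t) ≤ b t`; but `b`
    -- tends to `0` at `0`.
    set b : ℝ → ℝ := fun t => ‖γ₁ t - γ₂ t‖ / t * Real.exp (-(c * t)) with hb
    have b0 : Tendsto b (𝓝[>] 0) (𝓝 0) := by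
      have e1 : Tendsto (fun t : ℝ => ‖γ₁ t - γ₂ t‖ / t) (𝓝[>] 0) (𝓝 0) := by
        have := (d₁.sub d₂).tendsto_slope_zero_right.norm
        simp only [sub_self, zero_add, Pi.sub_apply, z₁, z₂, sub_zero, norm_zero] at this
        refine this.congr' ?_
        filter_upwards [self_mem_nhdsWithin] with t ht
        rw [norm_smul, norm_inv, Real.norm_of_nonneg (le_of_lt ht), div_eq_inv_mul]
      have e2 : Tendsto (fun t : ℝ => Real.exp (-(c * t))) (𝓝[>] 0) (𝓝 (Real.exp (-(c * 0)))) :=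
        (Continuous.tendsto (by fun_prop) 0).mono_left nhdsWithin_le_nhds
      simpa using e1.mul e2
    have step : ∀ t, 0 < t → t < δ → b (2 * t) ≤ b t := by
      intro t ht htδ
      obtain ⟨H1, H2⟩ := H (y := t) (by simpa [abs_of_pos ht] using htδ)
      rw [z₁, sub_zero, Real.norm_of_nonneg ht.le] at H1
      rw [z₂, sub_zero, Real.norm_of_nonneg ht.le] at H2
      have e : γ₁ (2 * t) - γ₂ (2 * t) = (γ₁ t - γ₂ t) + (γ₁ t - γ₂ t) +
          (γ₁ t - γ₂ t) * (γ₁ t - 1) + (γ₂ t - 1) * (γ₁ t - γ₂ t) := by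
        rw [h₁, h₂]; noncomm_ring
      have n1 : ‖γ₁ (2 * t) - γ₂ (2 * t)‖ ≤ 2 * ((1 + c * t) * ‖γ₁ t - γ₂ t‖) := by
        have hc : 0 ≤ c * t := by
          have := (norm_nonneg _).trans H1
          have := (norm_nonneg _).trans H2
          simp only [c, add_mul]; linarith
        calc _ ≤ ‖γ₁ t - γ₂ t‖ + ‖γ₁ t - γ₂ t‖ + ‖γ₁ t - γ₂ t‖ * ‖γ₁ t - 1‖ +
              ‖γ₂ t - 1‖ * ‖γ₁ t - γ₂ t‖ := by
              rw [e]
              exact (norm_add_le _ _).trans (add_le_add ((norm_add_le _ _).trans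
                (add_le_add (norm_add_le _ _) (norm_mul_le _ _))) (norm_mul_le _ _))
          _ ≤ ‖γ₁ t - γ₂ t‖ + ‖γ₁ t - γ₂ t‖ + ‖γ₁ t - γ₂ t‖ * (C₁ * t) +
              (C₂ * t) * ‖γ₁ t - γ₂ t‖ := by gcongr
          _ = (2 + c * t) * ‖γ₁ t - γ₂ t‖ := by simp only [c]; ring
          _ ≤ _ := by
            rw [← mul_assoc]
            gcongr
            linarith
      have n2 : 1 + c * t ≤ Real.exp (c * t) := by linarith [Real.add_one_le_exp (c * t)]
      calc b (2 * t) ≤ 2 * (Real.exp (c * t) * ‖γ₁ t - γ₂ t‖) / (2 * t) *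
            Real.exp (-(c * (2 * t))) := by
              simp only [hb]
              gcongr
              exact n1.trans (by gcongr)
        _ = ‖γ₁ t - γ₂ t‖ / t * (Real.exp (c * t) * Real.exp (-(c * (2 * t)))) := by
              field_simp
        _ = b t := by rw [← Real.exp_add, hb]; ring_nf
    intro t ht htδ
    have mono : ∀ n : ℕ, b t ≤ b (t / 2 ^ n) := by
      intro n
      induction n with
      | zero => simp
      | succ n ih =>
        have e : t / 2 ^ n = 2 * (t / 2 ^ (n + 1)) := by rw [pow_succ]; field_simp
        refine ih.trans (e ▸ step _ (by positivity) (lt_of_le_of_lt ?_ htδ))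
        exact div_le_self ht.le (one_le_pow₀ (by norm_num))
    have l0 : Tendsto (fun n : ℕ => b (t / 2 ^ n)) atTop (𝓝 0) :=
      b0.comp (tendsto_nhdsWithin_iff.mpr ⟨lim t, .of_forall fun n => Set.mem_Ioi.mpr (by positivity)⟩)
    have le0 : b t ≤ 0 := ge_of_tendsto' l0 mono
    have : ‖γ₁ t - γ₂ t‖ ≤ 0 := by
      have h1 := nonpos_of_mul_nonpos_left le0 (Real.exp_pos _)
      by_contra! hlt
      exact absurd h1 (not_le.mpr (div_pos hlt ht))
    exact sub_eq_zero.mp (norm_le_zero_iff.mp this)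
  obtain ⟨n, hn⟩ := ((lim s).eventually (gt_mem_nhds hδ)).exists
  exact half n (key _ (by positivity) hn)

/-! ### Holomorphic maps commuting with squaring are linear. -/

section SquareEquivariant

variable {A : Type*} [NormedRing A] [NormedAlgebra ℂ A]

/-- The value `e = g 0` is idempotent. If `e ≠ 0`, the preimage `M` of `(1 + c) e` has norm `< 1`
for small `c > 0`; then `M ^ 2 ^ n → 0`, whereas its image `(1 + c) ^ 2 ^ n • e` is unbounded
instead of tending to `e`. -/
theorem map_zero_of_map_sq (g : Equiv.Perm A) (hc : Continuous g) (hc' : Continuous g.symm)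
    (hsq : ∀ M, g (M ^ 2) = g M ^ 2) : g 0 = 0 := by
  by_contra he
  have hidem : ∀ n : ℕ, n ≠ 0 → g 0 ^ n = g 0 :=
    fun n hn => IsIdempotentElem.pow_eq (by simpa [sq] using (hsq 0).symm : g 0 * g 0 = g 0) hn
  have hpow : ∀ (n : ℕ) (M : A), g (M ^ 2 ^ n) = g M ^ 2 ^ n := by
    intro n M
    induction n with
    | zero => simp
    | succ n ih => rw [pow_succ, pow_mul, hsq, ih, ← pow_mul]
  have cont : Continuous fun c : ℝ => ‖g.symm (((1 + c : ℝ) : ℂ) • g 0)‖ := by fun_prop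
  have ev : ∀ᶠ c : ℝ in 𝓝[>] 0, ‖g.symm (((1 + c : ℝ) : ℂ) • g 0)‖ < 1 :=
    nhdsWithin_le_nhds (cont.continuousAt.eventually (gt_mem_nhds (by simp)))
  obtain ⟨c, hc1, hc0⟩ := (ev.and self_mem_nhdsWithin).exists
  have hc0 : 0 < c := hc0
  have two : Tendsto (fun n : ℕ => 2 ^ n) atTop atTop :=
    tendsto_pow_atTop_atTop_of_one_lt (one_lt_two : 1 < (2 : ℕ))
  have l1 := (hc.tendsto 0).comp ((tendsto_pow_atTop_nhds_zero_of_norm_lt_one hc1).comp two)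
  have l2 : Tendsto (fun n : ℕ => (1 + c) ^ 2 ^ n * ‖g 0‖) atTop (𝓝 ‖g 0‖) := by
    refine l1.norm.congr fun n => ?_
    simp only [Function.comp_apply]
    rw [hpow, Equiv.apply_symm_apply, smul_pow, hidem _ (by positivity), norm_smul, norm_pow,
      Complex.norm_real, Real.norm_of_nonneg (by positivity)]
  have l3 : Tendsto (fun n : ℕ => (1 + c) ^ 2 ^ n * ‖g 0‖) atTop atTop :=
    ((tendsto_pow_atTop_atTop_of_one_lt (by linarith)).comp two).atTop_mul_const
      (norm_pos_iff.mpr he)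
  exact not_tendsto_nhds_of_tendsto_atTop l3 _ l2

variable [CompleteSpace A] {h : A → A}

/-- Restricting to complex lines reduces the identity theorem to one variable. -/
theorem analyticOnNhd_comp_line (hd : Differentiable ℂ h) (x v : A) :
    AnalyticOnNhd ℂ (fun t : ℂ => h (x + t • v)) Set.univ := by
  have : Differentiable ℂ (fun t : ℂ => h (x + t • v)) := by fun_prop
  exact fun t _ => this.analyticAt t

/-- The relative error `v t = t⁻¹ h(t) - 1` satisfies `v (t²) = 2 v + v²`, so its norm does not
decrease under `t ↦ t²` while `‖v‖ ≤ 1`. Since it tends to `0` along `t ^ 2 ^ n`, it vanishes near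
`0`. -/
theorem map_smul_one_of_map_sq (hd : Differentiable ℂ h) (hsq : ∀ M, h (M ^ 2) = h M ^ 2)
    (h0 : h 0 = 0) (hD : HasFDerivAt h (ContinuousLinearMap.id ℂ A) 0) (t : ℂ) :
    h (t • (1 : A)) = t • 1 := by
  set v : ℂ → A := fun t => t⁻¹ • h (t • 1) - 1 with hv
  have v0 : Tendsto v (𝓝[≠] 0) (𝓝 0) := by
    have d : HasDerivAt (fun t : ℂ => h (t • (1 : A))) 1 0 := by
      have l : HasDerivAt (fun t : ℂ => t • (1 : A)) 1 0 := by
        simpa using (hasDerivAt_id (0 : ℂ)).smul_const (1 : A)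
      exact HasFDerivAt.comp_hasDerivAt (l := h) (0 : ℂ) (by simpa using hD) l
    have := d.tendsto_slope_zero
    simp only [zero_add, zero_smul, h0, sub_zero] at this
    simpa [hv] using this.sub_const 1
  have vsq : ∀ t, t ≠ 0 → v (t ^ 2) = v t + v t + v t * v t := by
    intro t ht
    have e : h (t ^ 2 • (1 : A)) = h (t • 1) ^ 2 := by
      rw [← hsq, smul_pow, one_pow]
    have e2 : (t ^ 2)⁻¹ • h (t • (1 : A)) ^ 2 = (t⁻¹ • h (t • 1)) ^ 2 := by
      rw [smul_pow, inv_pow]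
    simp only [hv]
    rw [e, e2]
    generalize t⁻¹ • h (t • (1 : A)) = w
    noncomm_ring
  have ev : ∀ᶠ t in 𝓝[≠] (0 : ℂ), ‖v t‖ ≤ 1 := by
    have := v0.norm
    rw [norm_zero] at this
    exact this.eventually (Iic_mem_nhds one_pos)
  obtain ⟨δ, hδ, H⟩ := Metric.eventually_nhds_iff.mp (eventually_nhdsWithin_iff.mp ev)
  have key : ∀ t : ℂ, t ≠ 0 → ‖t‖ < δ → ‖t‖ < 1 → v t = 0 := by
    intro t ht htδ ht1
    have mono : ∀ n : ℕ, ‖v t‖ ≤ ‖v (t ^ 2 ^ n)‖ := by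
      intro n
      induction n with
      | zero => simp
      | succ n ih =>
        refine ih.trans ?_
        have hs0 : t ^ 2 ^ n ≠ 0 := pow_ne_zero _ ht
        have hs : ‖v (t ^ 2 ^ n)‖ ≤ 1 := H (by
          rw [dist_zero_right, norm_pow]
          exact (pow_le_of_le_one (norm_nonneg _) ht1.le (by positivity)).trans_lt htδ) hs0
        rw [pow_succ 2, pow_mul, vsq _ hs0]
        set w := v (t ^ 2 ^ n)
        have e : w + w = (w + w + w * w) - w * w := by abel
        have e1 : ‖w + w‖ = 2 * ‖w‖ := by
          rw [← two_smul ℂ w, norm_smul]; norm_num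
        have e2 : ‖w + w‖ ≤ ‖w + w + w * w‖ + ‖w * w‖ := by
          conv_lhs => rw [e]
          exact norm_sub_le _ _
        have e3 : ‖w * w‖ ≤ ‖w‖ := (norm_mul_le _ _).trans
          (mul_le_of_le_one_left (norm_nonneg _) hs)
        linarith
    have l0 : Tendsto (fun n : ℕ => ‖v (t ^ 2 ^ n)‖) atTop (𝓝 0) := by
      have p : Tendsto (fun n : ℕ => t ^ 2 ^ n) atTop (𝓝[≠] 0) :=
        tendsto_nhdsWithin_iff.mpr ⟨(tendsto_pow_atTop_nhds_zero_of_norm_lt_one ht1).comp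
          (tendsto_pow_atTop_atTop_of_one_lt one_lt_two), .of_forall fun n => pow_ne_zero _ ht⟩
      simpa using (v0.comp p).norm
    exact norm_le_zero_iff.mp (ge_of_tendsto' l0 mono)
  have lin : AnalyticOnNhd ℂ (fun t : ℂ => t • (1 : A)) Set.univ := by
    have : Differentiable ℂ (fun t : ℂ => t • (1 : A)) := by fun_prop
    exact fun t _ => this.analyticAt t
  have an := analyticOnNhd_comp_line hd 0 (1 : A)
  simp only [zero_add] at an
  refine congrFun (an.eq_of_eventuallyEq (z₀ := 0) lin ?_) t
  filter_upwards [Metric.ball_mem_nhds (0 : ℂ) (lt_min hδ one_pos)] with t ht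
  rw [mem_ball_zero_iff, lt_min_iff] at ht
  rcases eq_or_ne t 0 with rfl | h1
  · simpa using h0
  · have := sub_eq_zero.mp (key t h1 ht.1 ht.2)
    rw [inv_smul_eq_iff₀ h1] at this
    exact this

/-- Rigidity of doubling makes `h` homogeneous on each line `ℂ • exp X`; the derivative of `h` at
`0` then fixes its value there. -/
theorem map_exp_of_map_sq (hd : Differentiable ℂ h) (hsq : ∀ M, h (M ^ 2) = h M ^ 2)
    (h0 : h 0 = 0) (hD : HasFDerivAt h (ContinuousLinearMap.id ℂ A) 0) (X : A) :
    h (NormedSpace.exp X) = NormedSpace.exp X := by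
  let : NormedAlgebra ℚ A := NormedAlgebra.restrictScalars ℚ ℂ A
  have h1 := map_smul_one_of_map_sq hd hsq h0 hD
  have h11 : h 1 = 1 := by simpa using h1 1
  obtain ⟨D, hD1⟩ : ∃ D : A →L[ℂ] A, HasFDerivAt h D 1 := ⟨_, (hd 1).hasFDerivAt⟩
  -- This makes the velocities `D (τ • 1 + X)` and `τ • 1 + D X` of the two curves compared below
  -- equal.
  have D1 : D 1 = 1 := by
    have l : HasDerivAt (fun t : ℂ => t • (1 : A)) 1 1 := by
      simpa using (hasDerivAt_id (1 : ℂ)).smul_const (1 : A)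
    have d : HasDerivAt (fun t : ℂ => h (t • (1 : A))) (D 1) 1 :=
      HasFDerivAt.comp_hasDerivAt (l := h) (1 : ℂ) (by simpa using hD1) l
    simp only [h1] at d
    exact d.unique l
  have e2 : ∀ (s : ℝ) (Y : A), NormedSpace.exp (((2 * s : ℝ) : ℂ) • Y) =
      NormedSpace.exp ((s : ℂ) • Y) ^ 2 := by
    intro s Y
    rw [← NormedSpace.exp_nsmul, ← Nat.cast_smul_eq_nsmul ℂ, smul_smul]
    push_cast; rfl
  have dexp : ∀ Y : A, HasDerivAt (fun s : ℝ => NormedSpace.exp ((s : ℂ) • Y)) Y 0 := by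
    intro Y
    have l : HasDerivAt (fun s : ℝ => (s : ℂ) • Y) Y 0 := by
      simpa using (Complex.ofRealCLM.hasDerivAt (x := (0 : ℝ))).smul_const Y
    have E : HasFDerivAt (𝕜 := ℝ) (NormedSpace.exp : A → A) 1 (((0 : ℝ) : ℂ) • Y) := by
      simpa using (hasFDerivAt_exp_zero (𝕂 := ℝ) (𝔸 := A))
    exact HasFDerivAt.comp_hasDerivAt (0 : ℝ) E l
  have dh : ∀ Y : A, HasDerivAt (fun s : ℝ => h (NormedSpace.exp ((s : ℂ) • Y))) (D Y) 0 := by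
    intro Y
    exact HasFDerivAt.comp_hasDerivAt (l := h) (l' := D.restrictScalars ℝ) (0 : ℝ)
      (by simpa using hD1.restrictScalars ℝ) (dexp Y)
  have hom : ∀ c : ℂ, h (c • NormedSpace.exp X) = c • h (NormedSpace.exp X) := by
    intro c
    rcases eq_or_ne c 0 with rfl | hc
    · simp [h0]
    obtain ⟨τ, rfl⟩ : ∃ τ, Complex.exp τ = c := ⟨_, Complex.exp_log hc⟩
    have ex : ∀ s : ℂ, NormedSpace.exp (s • (τ • (1 : A) + X)) =
        Complex.exp (s * τ) • NormedSpace.exp (s • X) := by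
      intro s
      rw [smul_add, smul_smul, NormedSpace.exp_add_of_commute, ← Algebra.algebraMap_eq_smul_one,
        ← NormedSpace.algebraMap_exp_comm, ← Complex.exp_eq_exp_ℂ, ← Algebra.smul_def]
      rw [← Algebra.algebraMap_eq_smul_one]
      exact Algebra.commutes _ _
    have := eq_of_doubling (s := 1)
      (γ₁ := fun s : ℝ => h (NormedSpace.exp ((s : ℂ) • (τ • (1 : A) + X))))
      (γ₂ := fun s : ℝ => Complex.exp (s * τ) • h (NormedSpace.exp ((s : ℂ) • X)))
      (a := D (τ • (1 : A) + X))
      (fun s => by rw [e2, hsq])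
      (fun s => by
        rw [e2, hsq, smul_pow, ← Complex.exp_nat_mul]
        push_cast
        rw [mul_assoc])
      (dh _)
      (by
        have dc : HasDerivAt (fun s : ℝ => Complex.exp (s * τ)) τ 0 := by
          have := ((hasDerivAt_id ((0 : ℝ) : ℂ)).mul_const τ).cexp.comp_ofReal
          simpa using this
        refine (dc.smul (dh X)).congr_deriv ?_
        simp [h11, D1, add_comm])
      (by simpa using h11) (by simpa using h11) one_pos
    simp only [ex] at this
    simpa using this
  -- The derivative of `t ↦ h (t • exp X)` at `0` is computed twice: by the chain rule and by
  -- homogeneity.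
  have l : HasDerivAt (fun t : ℂ => t • NormedSpace.exp X) (NormedSpace.exp X) 0 := by
    simpa using (hasDerivAt_id (0 : ℂ)).smul_const (NormedSpace.exp X)
  have l' : HasDerivAt (fun t : ℂ => t • h (NormedSpace.exp X)) (h (NormedSpace.exp X)) 0 := by
    simpa using (hasDerivAt_id (0 : ℂ)).smul_const (h (NormedSpace.exp X))
  have d : HasDerivAt (fun t : ℂ => h (t • NormedSpace.exp X)) (NormedSpace.exp X) 0 :=
    HasFDerivAt.comp_hasDerivAt (l := h) (l' := .id ℂ A) (0 : ℂ) (by simpa using hD) l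
  simp only [hom] at d
  exact l'.unique d

/-- An entire self-map of a complex Banach algebra that commutes with squaring and is tangent to
the identity at `0` is the identity. -/
theorem eq_id_of_map_sq (hd : Differentiable ℂ h) (hsq : ∀ M, h (M ^ 2) = h M ^ 2)
    (h0 : h 0 = 0) (hD : HasFDerivAt h (ContinuousLinearMap.id ℂ A) 0) : h = id := by
  have near : ∀ᶠ M in 𝓝 (1 : A), h M = M := by
    -- By the inverse function theorem, `exp` maps neighbourhoods of `0` onto neighbourhoods of `1`.
    have s : HasStrictFDerivAt (NormedSpace.exp : A → A)
        ((ContinuousLinearEquiv.refl ℂ A : A ≃L[ℂ] A) : A →L[ℂ] A) 0 :=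
      hasStrictFDerivAt_exp_zero (𝕂 := ℂ)
    have := s.map_nhds_eq_of_equiv
    rw [NormedSpace.exp_zero] at this
    rw [← this, eventually_map]
    exact .of_forall (map_exp_of_map_sq hd hsq h0 hD)
  funext M
  have an := analyticOnNhd_comp_line hd 1 (M - 1)
  have an' := analyticOnNhd_comp_line (differentiable_id : Differentiable ℂ (id : A → A)) 1 (M - 1)
  have := congrFun (an.eq_of_eventuallyEq (z₀ := 0) an' ?_) 1
  · simpa using this
  · have c : Tendsto (fun t : ℂ => 1 + t • (M - 1)) (𝓝 0) (𝓝 1) := by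
      have : Continuous (fun t : ℂ => 1 + t • (M - 1)) := by fun_prop
      simpa using this.tendsto 0
    exact c.eventually near

/-- A biholomorphism of a complex Banach algebra that commutes with squaring is linear. -/
theorem exists_linear_of_map_sq (g : Equiv.Perm A) (hd : Differentiable ℂ g)
    (hd' : Differentiable ℂ g.symm) (hsq : ∀ M, g (M ^ 2) = g M ^ 2) :
    ∃ L : A ≃L[ℂ] A, ∀ M, g M = L M := by
  have g0 := map_zero_of_map_sq g hd.continuous hd'.continuous hsq
  have g0' : g.symm 0 = 0 := by rw [Equiv.symm_apply_eq, g0]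
  obtain ⟨D, hD⟩ : ∃ D : A →L[ℂ] A, HasFDerivAt g D 0 := ⟨_, (hd 0).hasFDerivAt⟩
  obtain ⟨D', hD'⟩ : ∃ D : A →L[ℂ] A, HasFDerivAt g.symm D 0 := ⟨_, (hd' 0).hasFDerivAt⟩
  have c1 : D'.comp D = .id ℂ A := by
    have : HasFDerivAt (g.symm ∘ g) (D'.comp D) 0 := HasFDerivAt.comp 0 (by rwa [g0]) hD
    rw [Equiv.symm_comp_self] at this
    exact this.unique (hasFDerivAt_id 0)
  have c2 : D.comp D' = .id ℂ A := by
    have : HasFDerivAt (g ∘ g.symm) (D.comp D') 0 := HasFDerivAt.comp 0 (by rwa [g0']) hD'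
    rw [Equiv.self_comp_symm] at this
    exact this.unique (hasFDerivAt_id 0)
  let L : A ≃L[ℂ] A := .equivOfInverse D D' (fun x => congrArg (· x) c1) (fun x => congrArg (· x) c2)
  -- Let `t → 0` in `t⁻² g(t² M²) = (t⁻¹ g(t M))²`.
  have hDsq : ∀ M, D (M ^ 2) = D M ^ 2 := by
    intro M
    have d : ∀ X : A, Tendsto (fun t : ℂ => t⁻¹ • g (t • X)) (𝓝[≠] 0) (𝓝 (D X)) := by
      intro X
      have l : HasDerivAt (fun t : ℂ => t • X) X 0 := by
        simpa using (hasDerivAt_id (0 : ℂ)).smul_const X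
      have d : HasDerivAt (fun t : ℂ => g (t • X)) (D X) 0 :=
        HasFDerivAt.comp_hasDerivAt (l := g) (0 : ℂ) (by simpa using hD) l
      simpa [g0] using d.tendsto_slope_zero
    have q : Tendsto (fun t : ℂ => t ^ 2) (𝓝[≠] 0) (𝓝[≠] 0) := by
      refine tendsto_nhdsWithin_iff.mpr ⟨?_, ?_⟩
      · have : Continuous fun t : ℂ => t ^ 2 := by fun_prop
        simpa using (this.tendsto 0).mono_left nhdsWithin_le_nhds
      · filter_upwards [self_mem_nhdsWithin] with t ht using pow_ne_zero 2 ht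
    refine tendsto_nhds_unique ((d (M ^ 2)).comp q) (((d M).pow 2).congr fun t => ?_)
    simp only [Function.comp_apply]
    rw [← smul_pow, hsq, ← inv_pow, smul_pow]
  have hid := eq_id_of_map_sq (h := fun M => L.symm (g M))
    (L.symm.differentiable.comp hd)
    (fun M => L.injective <| by
      have e : ∀ X, L (X ^ 2) = L X ^ 2 := hDsq
      rw [e, L.apply_symm_apply, L.apply_symm_apply, hsq])
    (by simp [g0])
    (by
      have := (L.symm : A →L[ℂ] A).hasFDerivAt.comp (0 : A) hD
      exact this.congr_fderiv c1)
  refine ⟨L, fun M => ?_⟩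
  have := congrFun hid M
  exact (L.symm_apply_eq).mp this

end SquareEquivariant

/-! ### Jordan automorphisms of the `2 × 2` matrices. -/

section JordanAutomorphism

/-- Matrix units `A, B, C, 1 - A` in a ring that satisfy the Jordan relations of `E₁₁, E₁₂, E₂₁`
satisfy, up to exchanging `B` and `C`, the associative ones if `A` is a rank one idempotent. -/
theorem mul_eq_or_mul_eq_of_jordan_relations {A B C : Matrix (Fin 2) (Fin 2) ℂ}
    (hA : A * A = A) (hA1 : A ≠ 1) (hB : B * B = 0)
    (hAB : A * B + B * A = B) (hAC : A * C + C * A = C) (hBC : B * C + C * B = 1) :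
    B * C = A ∨ C * B = A := by
  have hdet : A.det = 0 := by
    by_contra hd
    have hu : IsUnit A := (Matrix.isUnit_iff_isUnit_det A).mpr (isUnit_iff_ne_zero.mpr hd)
    exact hA1 (hu.mul_left_cancel (by rw [hA, mul_one]))
  have rank1 : ∀ X, A * X * A = (A * X).trace • A := by
    intro X
    rw [Matrix.det_fin_two] at hdet
    ext i j
    fin_cases i <;> fin_cases j <;>
      simp [Matrix.mul_apply, Fin.sum_univ_two, Matrix.trace]
    · linear_combination (-X 1 1) * hdet
    · linear_combination (X 0 1 ) * hdet
    · linear_combination (X 1 0) * hdet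
    · linear_combination (-X 0 0) * hdet
  have hAB' : A * B = B - B * A := by rw [eq_sub_iff_add_eq, hAB]
  have hAC' : A * C = C - C * A := by rw [eq_sub_iff_add_eq, hAC]
  have hCB : C * B = 1 - B * C := by rw [eq_sub_iff_add_eq', hBC]
  have hBCB : B * C * B = B := by rw [mul_assoc, hCB, mul_sub, ← mul_assoc, hB]; simp
  have hQQ : B * C * (B * C) = B * C := by rw [← mul_assoc, hBCB]
  -- The idempotent `B C` commutes with `A`, which has rank at most one, so `A (B C)` is an
  -- idempotent multiple of `A`: it is `0` or `A`. Sandwiching `A (B C)` between `C` and `B` settles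
  -- the first case, and `A (C B)` between `B` and `C` the second.
  have comm : A * (B * C) = B * C * A := by
    rw [← mul_assoc, hAB', sub_mul, mul_assoc B A, hAC', mul_sub, mul_assoc, sub_sub_cancel]
  have hAQ : A * (B * C) = (A * (B * C)).trace • A := by
    rw [← rank1, mul_assoc, ← comm, ← mul_assoc A A, hA]
  have hid : A * (B * C) * (A * (B * C)) = A * (B * C) := by
    rw [mul_assoc, ← mul_assoc (B * C), ← comm, mul_assoc A, hQQ, ← mul_assoc, hA]
  set l := (A * (B * C)).trace
  have hl : A = 0 ∨ l = 0 ∨ l = 1 := by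
    rw [hAQ, smul_mul_smul_comm, hA, ← sub_eq_zero, ← sub_smul, smul_eq_zero] at hid
    rcases hid with h | h
    · right
      rcases mul_eq_zero.mp (show l * (l - 1) = 0 by linear_combination h) with h | h
      · exact .inl h
      · exact .inr (sub_eq_zero.mp h)
    · exact .inl h
  have z0 : A * (B * C) = 0 → C * B = A := by
    intro h
    have : C * (A * (B * C)) * B = 1 - A - B * C := by
      have e : C * A = C - A * C := by rw [hAC', sub_sub_cancel]
      calc C * (A * (B * C)) * B = C * A * (B * C * B) := by noncomm_ring
        _ = C * B - A * (C * B) := by rw [hBCB, e, sub_mul, mul_assoc]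
        _ = _ := by rw [hCB, mul_sub, h]; noncomm_ring
    rw [h, mul_zero, zero_mul] at this
    rw [hCB]
    rw [eq_comm, sub_right_comm, sub_eq_zero] at this
    exact this
  rcases hl with h | h | h
  · exact .inr (z0 (by rw [h, zero_mul]))
  · exact .inr (z0 (by rw [hAQ, h, zero_smul]))
  · left
    rw [h, one_smul] at hAQ
    have e : B * A = B - A * B := by rw [hAB', sub_sub_cancel]
    have : B * (A * (C * B)) * C = B * C - A * (B * C) := by
      calc B * (A * (C * B)) * C = B * A * (C * (B * C)) := by noncomm_ring
        _ = (B * C) * (B * C) - A * ((B * C) * (B * C)) := by rw [e]; noncomm_ring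
        _ = _ := by rw [hQQ]
    rw [hCB, mul_sub, mul_one, hAQ, sub_self, mul_zero, zero_mul] at this
    exact (sub_eq_zero.mp this.symm)

/-- A family `A, B, C, 1 - A` of `2 × 2` matrix units is conjugate to the standard one. -/
theorem exists_conj_of_matrix_units {A B C : Matrix (Fin 2) (Fin 2) ℂ}
    (hA : A * A = A) (hA0 : A ≠ 0) (hB : B * B = 0) (hC : C * C = 0)
    (hBC : B * C = A) (hCB : C * B = 1 - A) :
    ∃ P : GL (Fin 2) ℂ, ∀ a b c d : ℂ,
      a • A + b • B + c • C + d • (1 - A) = conjMap P !![a, b; c, d] := by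
  obtain ⟨v, hv⟩ : ∃ v, A.mulVec v ≠ 0 := by
    by_contra! h
    exact hA0 (Matrix.ext_of_mulVec_single fun i => by rw [h, Matrix.zero_mulVec])
  -- In the basis `A v, C v` the matrices `A, B, C` act as `E₁₁, E₁₂, E₂₁`.
  set P : Matrix (Fin 2) (Fin 2) ℂ := (Matrix.of ![A.mulVec v, C.mulVec v]).transpose with hP
  have hPv : ∀ x, P.mulVec x = x 0 • A.mulVec v + x 1 • C.mulVec v := by
    intro x
    ext i
    fin_cases i <;> simp [hP, Matrix.mulVec, dotProduct, Fin.sum_univ_two] <;> ring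
  have hBA : B * A = 0 := by rw [← hBC, ← mul_assoc, hB, zero_mul]
  have hAC : A * C = 0 := by rw [← hBC, mul_assoc, hC, mul_zero]
  have hAB : A * B = B := by rw [← hBC, mul_assoc, hCB, mul_sub, hBA, mul_one, sub_zero]
  have hCA : C * A = C := by rw [← hBC, ← mul_assoc, hCB, sub_mul, hAC, one_mul, sub_zero]
  have inj : ∀ x, P.mulVec x = 0 → x = 0 := by
    intro x hx
    rw [hPv] at hx
    have h1 := congrArg A.mulVec hx
    have h2 := congrArg B.mulVec hx
    simp only [Matrix.mulVec_add, Matrix.mulVec_smul, Matrix.mulVec_mulVec, Matrix.mulVec_zero,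
      hA, hBA, hAC, hBC, Matrix.zero_mulVec, smul_zero, add_zero, zero_add, smul_eq_zero, hv,
      or_false] at h1 h2
    ext i
    fin_cases i
    exacts [h1, h2]
  have hu : IsUnit P := Matrix.mulVec_injective_iff_isUnit.mp
    ((injective_iff_map_eq_zero P.mulVecLin).mpr inj)
  obtain ⟨P', hP'⟩ := hu
  refine ⟨P', fun a b c d => ?_⟩
  have int : (a • A + b • B + c • C + d • (1 - A)) * P = P * !![a, b; c, d] := by
    refine Matrix.ext_of_mulVec_single fun i => ?_
    rw [← Matrix.mulVec_mulVec, ← Matrix.mulVec_mulVec, hPv, hPv]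
    simp only [Matrix.mulVec_add, Matrix.mulVec_smul, Matrix.mulVec_mulVec, Matrix.add_mulVec,
      Matrix.smul_mulVec, Matrix.sub_mulVec, add_mul, sub_mul, smul_mul_assoc,
      hA, hBA, hAC, hBC, hCA, hC, one_mul, Matrix.zero_mulVec]
    fin_cases i <;> simp
  change _ = (P' : Matrix (Fin 2) (Fin 2) ℂ) * _ * _
  rw [hP', ← int, ← hP', mul_assoc, Units.mul_inv, mul_one]

/-- A linear automorphism of `M₂(ℂ)` that commutes with squaring is a conjugation, possibly
composed with the transposition. -/
theorem exists_conj_of_linear_map_sq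
    (L : Matrix (Fin 2) (Fin 2) ℂ ≃ₗ[ℂ] Matrix (Fin 2) (Fin 2) ℂ)
    (hsq : ∀ M, L (M ^ 2) = L M ^ 2) :
    ∃ P : GL (Fin 2) ℂ, (∀ M, L M = conjMap P M) ∨ ∀ M, L M = conjMap P M.transpose := by
  -- Polarisation of the squaring identity.
  have hj : ∀ M N, L (M * N + N * M) = L M * L N + L N * L M := by
    intro M N
    have h := hsq (M + N)
    have e : (M + N) ^ 2 = M ^ 2 + (M * N + N * M) + N ^ 2 := by noncomm_ring
    rw [e, map_add L M N, map_add, map_add, hsq, hsq] at h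
    have e' : (L M + L N) ^ 2 = L M ^ 2 + (L M * L N + L N * L M) + L N ^ 2 := by noncomm_ring
    rw [e'] at h
    simpa using h
  have h1 : L 1 = 1 := by
    have h := hj 1 (L.symm 1)
    rw [one_mul, mul_one, map_add, L.apply_symm_apply, one_mul, mul_one, ← two_smul ℂ,
      ← two_smul ℂ (L 1)] at h
    exact (smul_right_injective _ (two_ne_zero (α := ℂ)) h).symm
  have hs : ∀ {M N}, M * M = N → L M * L M = L N := by
    rintro M _ rfl
    rw [← sq, ← hsq, sq]
  have hj' : ∀ {M N K}, M * N + N * M = K → L M * L N + L N * L M = L K := by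
    rintro M N _ rfl
    exact (hj M N).symm
  set A := L !![1, 0; 0, 0] with hAdef
  set B := L !![0, 1; 0, 0] with hBdef
  set C := L !![0, 0; 1, 0] with hCdef
  have hA : A * A = A := hs (by ext i j; fin_cases i <;> fin_cases j <;> simp)
  have hA0 : A ≠ 0 := by
    rw [hAdef, Ne, map_eq_zero_iff L L.injective]
    intro h
    simpa using congrFun (congrFun h 0) 0
  have hA1 : A ≠ 1 := by
    rw [hAdef, Ne, ← h1, L.injective.eq_iff]
    intro h
    simpa using congrFun (congrFun h 1) 1
  have hB : B * B = 0 := by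
    rw [hs (N := 0), map_zero]; ext i j; fin_cases i <;> fin_cases j <;> simp
  have hC : C * C = 0 := by
    rw [hs (N := 0), map_zero]; ext i j; fin_cases i <;> fin_cases j <;> simp
  have hAB : A * B + B * A = B := hj' (by ext i j; fin_cases i <;> fin_cases j <;> simp)
  have hAC : A * C + C * A = C := hj' (by ext i j; fin_cases i <;> fin_cases j <;> simp)
  have hBC : B * C + C * B = 1 := by
    rw [hj' (K := 1), h1]; ext i j; fin_cases i <;> fin_cases j <;> simp
  have hL : ∀ a b c d : ℂ, L !![a, b; c, d] = a • A + b • B + c • C + d • (1 - A) := by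
    intro a b c d
    have e : !![a, b; c, d] = a • !![1, 0; 0, 0] + b • !![0, 1; 0, 0] + c • !![0, 0; 1, 0] +
        d • (1 - !![1, 0; 0, 0]) := by
      ext i j; fin_cases i <;> fin_cases j <;> simp
    rw [e]
    simp only [map_add, map_smul, map_sub, h1, A, B, C]
  rcases mul_eq_or_mul_eq_of_jordan_relations hA hA1 hB hAB hAC hBC with h | h
  · obtain ⟨P, hP⟩ := exists_conj_of_matrix_units hA hA0 hB hC h
      (by rw [eq_sub_iff_add_eq', ← h, hBC])
    refine ⟨P, .inl fun M => ?_⟩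
    rw [Matrix.eta_fin_two M, hL, hP]
  -- Here `B` and `C` exchange roles, which swaps the off-diagonal coordinates and produces the
  -- transpose.
  · obtain ⟨P, hP⟩ := exists_conj_of_matrix_units hA hA0 hC hB h
      (by rw [eq_sub_iff_add_eq, ← h, hBC])
    refine ⟨P, .inr fun M => ?_⟩
    rw [Matrix.eta_fin_two M, hL, add_right_comm (_ • A), hP]
    congr 1
    ext i j; fin_cases i <;> fin_cases j <;> simp

end JordanAutomorphism

/-! ### The group structure. -/

section SemidirectProduct

theorem conjMap_apply (P : GL (Fin 2) ℂ) (M : Matrix (Fin 2) (Fin 2) ℂ) :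
    conjMap P M = (P : Matrix (Fin 2) (Fin 2) ℂ) * M *
      ((P⁻¹ : GL (Fin 2) ℂ) : Matrix (Fin 2) (Fin 2) ℂ) := rfl

theorem conjMap_mul_apply (P : GL (Fin 2) ℂ) (M N : Matrix (Fin 2) (Fin 2) ℂ) :
    conjMap P (M * N) = conjMap P M * conjMap P N := by
  simp only [conjMap_apply, mul_assoc, Units.inv_mul_cancel_left]

theorem conjMap_mul (P Q : GL (Fin 2) ℂ) : conjMap (P * Q) = conjMap P * conjMap Q := by
  ext1 M
  simp only [Equiv.Perm.mul_apply, conjMap_apply, mul_inv_rev, Units.val_mul, mul_assoc]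

/-- Acting trivially means commuting with all matrices, and commuting with the matrix units already
forces `P` to be scalar. -/
theorem conjMap_eq_one_iff (P : GL (Fin 2) ℂ) :
    conjMap P = 1 ↔ P ∈ Subgroup.center (GL (Fin 2) ℂ) := by
  rw [Matrix.GeneralLinearGroup.mem_center_iff_val_mem_range_scalar,
    Matrix.mem_range_scalar_iff_commute_single, Equiv.ext_iff]
  have key : ∀ M, conjMap P M = M ↔ Commute M (P : Matrix (Fin 2) (Fin 2) ℂ) := by
    intro M
    rw [conjMap_apply, Units.mul_inv_eq_iff_eq_mul, eq_comm]
    rfl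
  simp only [Equiv.Perm.one_apply, key]
  refine ⟨fun h i j _ => h _, fun h M => ?_⟩
  have := (Matrix.mem_range_scalar_iff_commute_single (M := (P : Matrix (Fin 2) (Fin 2) ℂ))).mpr h
  obtain ⟨a, ha⟩ := this
  rw [← ha]
  exact (Matrix.scalar_commute a (fun r => Commute.all a r) M).symm

/-- This commutation rule is the compatibility required to define `semidirectHom`. -/
theorem transposeMap_mul_conjMap (P : GL (Fin 2) ℂ) :
    transposeMap * conjMap P = conjMap (transposeGL P)⁻¹ * transposeMap := by
  ext1 M
  change (conjMap P M).transpose = conjMap (transposeGL P)⁻¹ M.transpose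
  rw [conjMap_apply, conjMap_apply, Matrix.transpose_mul, Matrix.transpose_mul, ← mul_assoc,
    inv_inv]
  rfl

theorem transposeMap_sq : transposeMap ^ 2 = 1 := by
  ext1 M
  rw [sq]
  exact M.transpose_transpose

/-- Conjugation preserves products and transposition reverses them; `E₁₁ E₁₂` tells them apart. -/
theorem conjMap_ne_transposeMap (P : GL (Fin 2) ℂ) : conjMap P ≠ transposeMap := by
  intro h
  have hm : ∀ M N : Matrix (Fin 2) (Fin 2) ℂ, (M * N).transpose = M.transpose * N.transpose := by
    intro M N
    have := conjMap_mul_apply P M N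
    rwa [h] at this
  have := congrFun (congrFun (hm !![1, 0; 0, 0] !![0, 1; 0, 0]) 1) 0
  simp [Matrix.mul_apply, Fin.sum_univ_two] at this

theorem conjMap_mem (P : GL (Fin 2) ℂ) :
    conjMap P ∈ holAutCentralizer (Matrix (Fin 2) (Fin 2) ℂ) squareMap := by
  have hd : ∀ U V : Matrix (Fin 2) (Fin 2) ℂ, Differentiable ℂ fun M => U * M * V :=
    fun U V => (differentiable_id.const_mul U).mul_const V
  refine ⟨hd _ _, hd _ _, funext fun M => ?_⟩
  simp only [Function.comp_apply, squareMap, sq, conjMap_mul_apply]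

theorem transposeMap_mem :
    transposeMap ∈ holAutCentralizer (Matrix (Fin 2) (Fin 2) ℂ) squareMap := by
  have hd : Differentiable ℂ fun M : Matrix (Fin 2) (Fin 2) ℂ => M.transpose :=
    (LinearMap.toContinuousLinearMap
      (Matrix.transposeLinearEquiv (Fin 2) (Fin 2) ℂ ℂ).toLinearMap).differentiable
  exact ⟨hd, hd, funext fun M => Matrix.transpose_pow M 2⟩

/-- An automorphism of `M₂(ℂ)` that commutes with squaring is `σ_P` or `σ_P ∘ 𝒯`. -/
theorem eq_conjMap_or_of_mem {g : Equiv.Perm (Matrix (Fin 2) (Fin 2) ℂ)}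
    (hg : g ∈ holAutCentralizer (Matrix (Fin 2) (Fin 2) ℂ) squareMap) :
    ∃ P : GL (Fin 2) ℂ, g = conjMap P ∨ g = conjMap P * transposeMap := by
  obtain ⟨hd, hd', hc⟩ := hg
  have hsq : ∀ M, g (M ^ 2) = g M ^ 2 := congrFun hc
  obtain ⟨L, hL⟩ := exists_linear_of_map_sq g hd hd' hsq
  obtain ⟨P, hP⟩ := exists_conj_of_linear_map_sq L.toLinearEquiv fun M => by
    have := hsq M
    rwa [hL, hL] at this
  refine ⟨P, hP.imp (fun h => Equiv.ext fun M => ?_) fun h => Equiv.ext fun M => ?_⟩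
  · exact (hL M).trans (h M)
  · exact (hL M).trans (h M)

/-- The homomorphism `[P] ↦ σ_P`. -/
noncomputable def conjHom : PGL(2, ℂ) →* holAutCentralizer (Matrix (Fin 2) (Fin 2) ℂ) squareMap :=
  QuotientGroup.lift (Subgroup.center (GL (Fin 2) ℂ))
    (MonoidHom.mk' (fun P => ⟨conjMap P, conjMap_mem P⟩) fun P Q => Subtype.ext (conjMap_mul P Q))
    fun P hP => Subtype.ext ((conjMap_eq_one_iff P).mpr hP)

theorem coe_conjHom_mk (P : GL (Fin 2) ℂ) :
    (conjHom (Matrix.ProjGenLinGroup.mk P) : Equiv.Perm (Matrix (Fin 2) (Fin 2) ℂ)) = conjMap P :=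
  rfl

/-- The homomorphism from `ℤ/2ℤ` that sends the nontrivial element to the transposition. -/
noncomputable def transposeHom :
    Multiplicative (ZMod 2) →* holAutCentralizer (Matrix (Fin 2) (Fin 2) ℂ) squareMap where
  toFun ε := ⟨transposeMap, transposeMap_mem⟩ ^ (Multiplicative.toAdd ε).val
  map_one' := by rw [toAdd_one, ZMod.val_zero, pow_zero]
  map_mul' a b := by
    rw [toAdd_mul, ZMod.val_add, ← pow_add]
    exact (pow_eq_pow_mod _ (Subtype.ext transposeMap_sq)).symm

theorem coe_transposeHom_ofAdd_one :
    (transposeHom (Multiplicative.ofAdd 1) : Equiv.Perm (Matrix (Fin 2) (Fin 2) ℂ)) =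
      transposeMap := by
  change ((⟨transposeMap, transposeMap_mem⟩ :
    holAutCentralizer (Matrix (Fin 2) (Fin 2) ℂ) squareMap) ^ 1).1 = _
  rw [pow_one]

theorem multiplicative_zmod_two_cases (ε : Multiplicative (ZMod 2)) :
    ε = 1 ∨ ε = Multiplicative.ofAdd 1 := by
  revert ε
  decide

/-- The homomorphism `PGL(2; ℂ) ⋊ ℤ/2ℤ → Aut(M₂(ℂ); M ↦ M²)`. -/
noncomputable def semidirectHom : (PGL(2, ℂ) ⋊[contragredientAction] Multiplicative (ZMod 2)) →*
    holAutCentralizer (Matrix (Fin 2) (Fin 2) ℂ) squareMap :=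
  SemidirectProduct.lift conjHom transposeHom fun ε => by
    ext1 p
    induction p using Matrix.ProjGenLinGroup.induction_on with
    | mk P =>
      rcases multiplicative_zmod_two_cases ε with rfl | rfl
      · simp
      · have e : contragredientAction (Multiplicative.ofAdd 1) = contragredientPGL := pow_one _
        apply Subtype.ext
        simp only [MonoidHom.comp_apply, MulEquiv.coe_toMonoidHom, e, contragredientPGL_mk,
          MulAut.conj_apply, Subgroup.coe_mul, Subgroup.coe_inv, coe_conjHom_mk,
          coe_transposeHom_ofAdd_one]
        rw [eq_mul_inv_iff_mul_eq, transposeMap_mul_conjMap]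

theorem semidirectHom_inl (p : PGL(2, ℂ)) :
    semidirectHom (SemidirectProduct.inl p) = conjHom p :=
  SemidirectProduct.lift_inl _ _ _ _

theorem semidirectHom_inr (ε : Multiplicative (ZMod 2)) :
    semidirectHom (SemidirectProduct.inr ε) = transposeHom ε :=
  SemidirectProduct.lift_inr _ _ _ _

theorem semidirectHom_injective : Function.Injective semidirectHom := by
  rw [injective_iff_map_eq_one]
  intro x hx
  rw [← SemidirectProduct.inl_left_mul_inr_right x] at hx ⊢
  generalize x.left = p at hx ⊢
  induction p using Matrix.ProjGenLinGroup.induction_on with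
  | mk P =>
    rw [map_mul, semidirectHom_inl, semidirectHom_inr] at hx
    rcases multiplicative_zmod_two_cases x.right with h | h
    · rw [h, map_one, mul_one] at hx ⊢
      have : conjMap P = 1 := congrArg Subtype.val hx
      rw [Matrix.ProjGenLinGroup.mk_eq_one.mpr ((conjMap_eq_one_iff P).mp this), map_one]
    · rw [h] at hx
      -- Since `𝒯` is an involution, this would give `σ_P = 𝒯`.
      have : conjMap P * transposeMap = 1 := by
        rw [← coe_conjHom_mk, ← coe_transposeHom_ofAdd_one]
        exact congrArg Subtype.val hx
      rw [mul_eq_one_iff_eq_inv, inv_eq_of_mul_eq_one_left (sq transposeMap ▸ transposeMap_sq)]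
        at this
      exact absurd this (conjMap_ne_transposeMap P)

theorem semidirectHom_surjective : Function.Surjective semidirectHom := by
  rintro ⟨g, hg⟩
  obtain ⟨P, rfl | rfl⟩ := eq_conjMap_or_of_mem hg
  · exact ⟨.inl (.mk P), semidirectHom_inl _⟩
  · refine ⟨.inl (.mk P) * .inr (.ofAdd 1), ?_⟩
    rw [map_mul, semidirectHom_inl, semidirectHom_inr]
    apply Subtype.ext
    rw [Subgroup.coe_mul, coe_conjHom_mk, coe_transposeHom_ofAdd_one]

end SemidirectProduct

theorem mainTheorem1 :
    Subgroup.closure (insert transposeMap (Set.range conjMap)) =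
      holAutCentralizer (Matrix (Fin 2) (Fin 2) ℂ) squareMap ∧
    ∃ e : (PGL(2, ℂ) ⋊[contragredientAction] Multiplicative (ZMod 2)) ≃*
        holAutCentralizer (Matrix (Fin 2) (Fin 2) ℂ) squareMap,
      (∀ P : GL (Fin 2) ℂ,
        (e (SemidirectProduct.inl (Matrix.ProjGenLinGroup.mk P)) :
          Equiv.Perm (Matrix (Fin 2) (Fin 2) ℂ)) = conjMap P) ∧
      (e (SemidirectProduct.inr (Multiplicative.ofAdd 1)) :
        Equiv.Perm (Matrix (Fin 2) (Fin 2) ℂ)) = transposeMap := by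
  refine ⟨le_antisymm ?_ fun g hg => ?_,
    MulEquiv.ofBijective semidirectHom ⟨semidirectHom_injective, semidirectHom_surjective⟩,
    fun P => ?_, ?_⟩
  · rw [Subgroup.closure_le, Set.insert_subset_iff]
    exact ⟨transposeMap_mem, Set.range_subset_iff.mpr conjMap_mem⟩
  · have hc : ∀ P, conjMap P ∈ Subgroup.closure (insert transposeMap (Set.range conjMap)) :=
      fun P => Subgroup.subset_closure (.inr ⟨P, rfl⟩)
    obtain ⟨P, rfl | rfl⟩ := eq_conjMap_or_of_mem hg
    · exact hc P
    · exact mul_mem (hc P) (Subgroup.subset_closure (.inl rfl))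
  · exact congrArg Subtype.val (semidirectHom_inl (.mk P))
  · exact (congrArg Subtype.val (semidirectHom_inr _)).trans
      coe_transposeHom_ofAdd_one
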